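/- Let $\mathcal K$ be a finite set of decorations with $|\mathcal K| = L$. A $\mathcal K$-decorated graphon $W$ is a family of symmetric measurable functions $w^{(l)} : [0,1]^2 \to [0,1]$, $l\in\mathcal K$, with $\sum_l w^{(l)} = 1$; write $W(x,y)=(w^{(l)}(x,y))_l$. For $\alpha\in(0,1]$ let $\mathcal H(\alpha,M)$ be the class of those $W$ with $\|W(x,y)-W(x',y')\|_1\le M\,\|(x,y)-(x',y')\|_1^{\alpha}$ for all $(x,y),(x',y')\in(0,1)^2$. Sampling: $\xi_1,\dots,\xi_n$ are i.i.d. uniform on $[0,1]$; given $\xi$, the decorations $A_{ij}=A_{ji}\in\mathcal K$ ($1\le i\le j\le n$) are independent with $A_{ij}\sim W(\xi_i,\xi_j)$. Put $\theta_{ij}=W(\xi_i,\xi_j)\in[0,1]^L$ and let $X_{ij}\in\{0,1\}^L$ be the indicator vector of $A_{ij}$, i.e. $X_{ij}^{(l)}=1$ if and only if $A_{ij}=l$. Let $\Theta_{s,k}$ be the set of parameter matrices of $(s,k)$-stochastic shape models, that is, of all arrays of the form $\theta_{ij}=Q_{u(g(i),g(j))}$ ($i,j\in[n]$) with a map $g:[n]\to[k]$,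 a symmetric map $u:[k]^2\to[s]$ (so some groups or shapes may be empty) and vectors $Q_c\in[0,1]^L$. The least-squares estimator $\hat\theta$ is a function of $A$ with $\hat\theta\in\operatorname{argmin}_{\theta\in\Theta_{s,k}} n^{-2}\sum_{i,j}\|X_{ij}-\theta_{ij}\|_2^2$, ties being broken arbitrarily. Theorem. Let $M\in\mathbb R$. There is a constant $C_1>0$ depending only on $M$ such that for every $\alpha\in(0,1]$ there is a constant $\beta\ge1$ for which the following holds with $k=\lceil n^{1/(\alpha+1)}\rceil$ and $s=\lceil n^{2\beta^{-1}/(\alpha\wedge1+1)}\rceil$. (1) For every $C'>0$ there is a constant $C>0$, depending only on $C',M,\alpha,\beta$, such that for every finite $\mathcal K$ with $|\mathcal K|=L$, every $n>L$ and every $W\in\mathcal H(\alpha,M)$, $$\frac1{n^2}\sum_{i,j}\|\hat\theta_{ij}-\theta_{ij}\|_2^2\le C\Big(L\,n^{-2\alpha/(\alpha+1)}+\frac{\log n}{n}\Big)$$ with probability at least $1-\exp(-C'n)$. (2) For every finite $\mathcal K$ with $|\mathcal K|=L$ and every $n>L$, $$\sup_{W\in\mathcal H(\alpha,M)}\mathbb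 E\Big[\frac1{n^2}\sum_{i,j}\|\hat\theta_{ij}-\theta_{ij}\|_2^2\Big]\le C_1\Big(L\,n^{-2\alpha/(\alpha+1)}+\frac{\log n}{n}\Big).$$ Probability and expectation are taken jointly over $(A_{ij})$ and $(\xi_i)$. -/

import Mathlib

open MeasureTheory ProbabilityTheory
open scoped ENNReal

/-- A decorated graphon over a finite decoration set `K`: symmetric measurable functions
`w l : [0,1]² → [0,1]`, one for each decoration `l`, which sum to one at every point. The number
`w l x y` is the probability of the decoration `l` under `W(x, y)`. -/
structure DecoratedGraphon (K : Type*) [Fintype K] where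
  w : K → unitInterval → unitInterval → ℝ
  measurable_w : ∀ l, Measurable fun p : unitInterval × unitInterval => w l p.1 p.2
  symm : ∀ l x y, w l x y = w l y x
  nonneg : ∀ l x y, 0 ≤ w l x y
  sum_eq_one : ∀ x y, ∑ l, w l x y = 1

/-- A `K`-decorated graph on `n` nodes: a symmetric array `A : [n] × [n] → K`, stored as a function
of the unordered pair `s(i, j)`. -/
abbrev DecoratedGraph (n : ℕ) (K : Type*) : Type _ := Sym2 (Fin n) → K

namespace DecoratedGraphon

variable {K : Type*} [Fintype K]

/-- `W ∈ ℋ(α, M)`: the graphon is `α`-Hölder with constant `M` on the open unit square, for the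
`ℓ¹` norms on `ℝ^L` and on the plane. -/
def IsHolder (α M : ℝ) (W : DecoratedGraphon K) : Prop :=
  ∀ x ∈ Set.Ioo (0 : unitInterval) 1, ∀ y ∈ Set.Ioo (0 : unitInterval) 1,
  ∀ x' ∈ Set.Ioo (0 : unitInterval) 1, ∀ y' ∈ Set.Ioo (0 : unitInterval) 1,
    ∑ l, |W.w l x y - W.w l x' y'| ≤ M * (|(x : ℝ) - x'| + |(y : ℝ) - y'|) ^ α

/-- The probability matrix `θ_ij = W(ξ_i, ξ_j) ∈ [0,1]^L`, for `i, j ∈ [n]`. -/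
def probs (W : DecoratedGraphon K) {n : ℕ} (ξ : Fin n → unitInterval) :
    Fin n → Fin n → K → ℝ :=
  fun i j l => W.w l (ξ i) (ξ j)

/-- The probability that the unordered pair `e = s(i, j)` gets the decoration `l` when the latent
variables are `ξ`, that is `w l (ξ i) (ξ j)`. -/
def edgeProb (W : DecoratedGraphon K) {n : ℕ} (ξ : Fin n → unitInterval) (e : Sym2 (Fin n))
    (l : K) : ℝ :=
  Sym2.lift ⟨fun i j => W.w l (ξ i) (ξ j), fun i j => W.symm l (ξ i) (ξ j)⟩ e

theorem edgeProb_mk (W : DecoratedGraphon K) {n : ℕ} (ξ : Fin n → unitInterval) (i j : Fin n)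
    (l : K) : W.edgeProb ξ s(i, j) l = W.w l (ξ i) (ξ j) := rfl

theorem edgeProb_nonneg (W : DecoratedGraphon K) {n : ℕ} (ξ : Fin n → unitInterval)
    (e : Sym2 (Fin n)) (l : K) : 0 ≤ W.edgeProb ξ e l := by
  induction e with
  | _ i j => exact W.nonneg l _ _

theorem sum_edgeProb (W : DecoratedGraphon K) {n : ℕ} (ξ : Fin n → unitInterval)
    (e : Sym2 (Fin n)) : ∑ l, W.edgeProb ξ e l = 1 := by
  induction e with
  | _ i j => exact W.sum_eq_one _ _

theorem measurable_edgeProb (W : DecoratedGraphon K) {n : ℕ} (e : Sym2 (Fin n)) (l : K) :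
    Measurable fun ξ : Fin n → unitInterval => W.edgeProb ξ e l := by
  induction e with
  | _ i j =>
    have h : Measurable fun ξ : Fin n → unitInterval => (ξ i, ξ j) :=
      (measurable_pi_apply i).prodMk (measurable_pi_apply j)
    exact (W.measurable_w l).comp h

variable [MeasurableSpace K] [DiscreteMeasurableSpace K]

/-- The law on `K` of the decoration of the pair `e = s(i, j)` given the latent variables: the
distribution `W(ξ_i, ξ_j)`. -/
noncomputable def edgeLaw (W : DecoratedGraphon K) {n : ℕ} (ξ : Fin n → unitInterval)
    (e : Sym2 (Fin n)) : Measure K :=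
  ∑ l, ENNReal.ofReal (W.edgeProb ξ e l) • Measure.dirac l

theorem edgeLaw_singleton (W : DecoratedGraphon K) {n : ℕ} (ξ : Fin n → unitInterval)
    (e : Sym2 (Fin n)) (l : K) : W.edgeLaw ξ e {l} = ENNReal.ofReal (W.edgeProb ξ e l) := by
  classical
  simp [edgeLaw, Measure.finsetSum_apply, Set.indicator_apply]

instance (W : DecoratedGraphon K) {n : ℕ} (ξ : Fin n → unitInterval) (e : Sym2 (Fin n)) :
    IsProbabilityMeasure (W.edgeLaw ξ e) := by
  constructor
  simp only [edgeLaw, Measure.finsetSum_apply, Measure.smul_apply, measure_univ, smul_eq_mul,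
    mul_one]
  rw [← ENNReal.ofReal_sum_of_nonneg (fun l _ => W.edgeProb_nonneg ξ e l), W.sum_edgeProb,
    ENNReal.ofReal_one]

/-- The conditional law of the decorated graph given the latent variables `ξ`: the decorations of
the unordered pairs are independent and `A_ij` has distribution `W(ξ_i, ξ_j)`. -/
noncomputable def graphKernel (W : DecoratedGraphon K) (n : ℕ) :
    Kernel (Fin n → unitInterval) (DecoratedGraph n K) where
  toFun ξ := Measure.pi fun e => W.edgeLaw ξ e
  measurable' := by
    classical
    refine Measure.measurable_of_measurable_coe _ fun S _ => ?_
    have h : ∀ ξ : Fin n → unitInterval, (Measure.pi fun e => W.edgeLaw ξ e) S =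
        ∑ a ∈ S.toFinite.toFinset, ∏ e, ENNReal.ofReal (W.edgeProb ξ e (a e)) := fun ξ => by
      conv_lhs => rw [← S.toFinite.coe_toFinset, ← sum_measure_singleton]
      simp [Measure.pi_singleton, edgeLaw_singleton]
    simp only [h]
    exact Finset.measurable_fun_sum _ fun a _ => Finset.measurable_fun_prod _ fun e _ =>
      (W.measurable_edgeProb e (a e)).ennreal_ofReal

instance (W : DecoratedGraphon K) (n : ℕ) : IsMarkovKernel (W.graphKernel n) :=
  ⟨fun ξ => inferInstanceAs (IsProbabilityMeasure (Measure.pi fun e => W.edgeLaw ξ e))⟩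

/-- The joint law of the latent variables and of the observed graph: `ξ_1, …, ξ_n` are independent
and uniform on `[0,1]`, and given `ξ` the graph is drawn from `graphKernel`. -/
noncomputable def sampleLaw (W : DecoratedGraphon K) (n : ℕ) :
    Measure ((Fin n → unitInterval) × DecoratedGraph n K) :=
  (volume : Measure (Fin n → unitInterval)) ⊗ₘ W.graphKernel n

end DecoratedGraphon

/-- The single-entry binary vectors `X_ij ∈ {0,1}^L`, with `X_ij l = 1` if and only if
`A_ij = l`. -/
def oneHot {n : ℕ} {K : Type*} [DecidableEq K] (A : DecoratedGraph n K) :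
    Fin n → Fin n → K → ℝ :=
  fun i j l => if A s(i, j) = l then 1 else 0

/-- The normalized squared Frobenius distance `n⁻² ∑_ij ‖θ_ij - η_ij‖₂²`. -/
noncomputable def meanSqDist {n : ℕ} {K : Type*} [Fintype K] (θ η : Fin n → Fin n → K → ℝ) : ℝ :=
  (1 / (n : ℝ) ^ 2) * ∑ i, ∑ j, ∑ l, (θ i j l - η i j l) ^ 2

/-- The set `Θ_{s,k}` of the `n × n` parameter matrices of `(s, k)`-stochastic shape models: the
nodes are assigned to `k` groups, the `k × k` blocks are merged symmetrically into shapes labelled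
by `1, …, s`, and `θ_ij` is the constant `Q_c ∈ [0,1]^L` of the shape `c` of the pair `(i, j)`.
Some groups and some shapes may be empty. -/
def shapeModelParams (n s k : ℕ) (K : Type*) : Set (Fin n → Fin n → K → ℝ) :=
  {θ | ∃ (g : Fin n → Fin k) (u : Fin k → Fin k → Fin s) (Q : Fin s → K → ℝ),
    (∀ a b, u a b = u b a) ∧ (∀ c l, Q c l ∈ Set.Icc (0 : ℝ) 1) ∧
      ∀ i j, θ i j = Q (u (g i) (g j))}

/-- `est` is a least-squares estimator over `Θ_{s,k}`: a function of the observed graph `A` whose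
value is always a minimizer of `n⁻² ‖X - θ‖_F²` over `θ ∈ Θ_{s,k}`, ties being broken in any way. -/
def IsLeastSquaresEstimator {n : ℕ} {K : Type*} [Fintype K] [DecidableEq K] (s k : ℕ)
    (est : DecoratedGraph n K → Fin n → Fin n → K → ℝ) : Prop :=
  ∀ A, est A ∈ shapeModelParams n s k K ∧
    IsMinOn (fun θ => meanSqDist (oneHot A) θ) (shapeModelParams n s k K) (est A)

/-- The number of shapes `s = ⌈n^{2β⁻¹/(α ∧ 1 + 1)}⌉`. -/
noncomputable def numShapes (α β : ℝ) (n : ℕ) : ℕ :=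
  ⌈(n : ℝ) ^ (2 * β⁻¹ / (min α 1 + 1))⌉₊

/-- The number of groups `k = ⌈n^{1/(α + 1)}⌉`. -/
noncomputable def numGroups (α : ℝ) (n : ℕ) : ℕ :=
  ⌈(n : ℝ) ^ (1 / (α + 1))⌉₊

/-- The rate `L n^{-2α/(α+1)} + log n / n`. -/
noncomputable def holderRate (L : ℕ) (α : ℝ) (n : ℕ) : ℝ :=
  L * (n : ℝ) ^ (-2 * α / (α + 1)) + Real.log n / n

/-!
Comparing the estimator with a fixed array `θ'` of `Θ_{s,k}`, the least-squares property bounds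
the loss by the approximation error of `θ'` and by the energy of the projection of the noise
`X - θ` onto the span of `θ'` and the arrays that are constant on the blocks of the estimated
assignment, a space of dimension at most `L k² + 1`. Given `ξ`, the noise has independent entries
up to symmetry and is therefore a sub-Gaussian vector, so the exponential moment of the energy of
its projection onto a fixed space is at most `√2` to the dimension; summing over the `kⁿ`
assignments adds `n log k` to the logarithm. Both the tail bound (Chernoff) and the mean bound
(Jensen) come from this single exponential moment.

For `W ∈ ℋ(α, M)`, sampling `W` at the midpoints of `k` equal cells gives an approximation error
of at most `M² k^{-2α}`. With `β = 1` and `n ≥ 16` there are enough shapes for every unordered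
pair of groups to have its own, since `s ≥ (k + 1).choose 2`. For `n < 16` the bound holds
trivially, as the loss never exceeds `L`.
-/

open scoped NNReal RealInnerProductSpace

section GaussianMoments

theorem integral_exp_mul_sq_gaussianReal {b : ℝ} (hb : b < 1) :
    ∫ x, Real.exp (b * x ^ 2 / 2) ∂(gaussianReal 0 1) = (√(1 - b))⁻¹ := by
  have hpdf (x : ℝ) : gaussianPDFReal 0 1 x • Real.exp (b * x ^ 2 / 2) =
      (√(2 * Real.pi))⁻¹ * Real.exp (-((1 - b) / 2) * x ^ 2) := by
    rw [gaussianPDFReal, smul_eq_mul, mul_assoc, ← Real.exp_add]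
    simp only [NNReal.coe_one, mul_one, sub_zero]
    ring_nf
  have hb' : 0 < 1 - b := sub_pos.2 hb
  rw [integral_gaussianReal_eq_integral_smul one_ne_zero, integral_congr_ae (ae_of_all _ hpdf),
    integral_const_mul, integral_gaussian, ← Real.sqrt_inv, ← Real.sqrt_mul (by positivity),
    ← Real.sqrt_inv]
  congr 1
  field_simp

theorem integrable_exp_mul_sq_gaussianReal {b : ℝ} (hb : b < 1) :
    Integrable (fun x : ℝ => Real.exp (b * x ^ 2 / 2)) (gaussianReal 0 1) :=
  .of_integral_ne_zero <| by
    rw [integral_exp_mul_sq_gaussianReal hb]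
    exact inv_ne_zero (Real.sqrt_pos.2 (sub_pos.2 hb)).ne'

variable {E : Type*} [NormedAddCommGroup E] [InnerProductSpace ℝ E] [FiniteDimensional ℝ E]
  [MeasurableSpace E] [BorelSpace E]

theorem lintegral_exp_inner_stdGaussian (v : E) :
    ∫⁻ x, ENNReal.ofReal (Real.exp ⟪x, v⟫) ∂(stdGaussian E) =
      ENNReal.ofReal (Real.exp (‖v‖ ^ 2 / 2)) := by
  set L : StrongDual ℝ E := innerSL ℝ v
  have hmap : (stdGaussian E).map L = gaussianReal 0 (‖v‖ ^ 2).toNNReal := by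
    rw [IsGaussian.map_eq_gaussianReal, integral_strongDual_stdGaussian,
      variance_dual_stdGaussian, innerSL_apply_norm]
  have hmgf : ∫ x, Real.exp ⟪x, v⟫ ∂(stdGaussian E) = Real.exp (‖v‖ ^ 2 / 2) := by
    simpa [mgf, L, real_inner_comm] using mgf_gaussianReal hmap 1
  rw [← ofReal_integral_eq_lintegral_ofReal _ (ae_of_all _ fun _ => (Real.exp_pos _).le), hmgf]
  exact .of_integral_ne_zero (hmgf ▸ (Real.exp_pos _).ne')

theorem lintegral_exp_mul_norm_sq_stdGaussian {b : ℝ} (hb : b < 1) :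
    ∫⁻ x, ENNReal.ofReal (Real.exp (b * ‖x‖ ^ 2 / 2)) ∂(stdGaussian E) =
      ENNReal.ofReal ((√(1 - b))⁻¹ ^ Module.finrank ℝ E) := by
  set β := stdOrthonormalBasis ℝ E
  have hprod (x : Fin (Module.finrank ℝ E) → ℝ) :
      Real.exp (b * ‖∑ i, x i • β i‖ ^ 2 / 2) = ∏ i, Real.exp (b * x i ^ 2 / 2) := by
    rw [← β.sum_sq_norm_inner_right, ← Real.exp_sum, Finset.mul_sum, Finset.sum_div]
    simp_rw [β.orthonormal.inner_right_fintype, Real.norm_eq_abs, sq_abs]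
  rw [stdGaussian_eq_map_pi_orthonormalBasis β, lintegral_map (by fun_prop) (by fun_prop)]
  simp_rw [hprod]
  rw [← ofReal_integral_eq_lintegral_ofReal
      (.fintype_prod (f := fun _ t => Real.exp (b * t ^ 2 / 2))
        fun _ => integrable_exp_mul_sq_gaussianReal hb)
      (ae_of_all _ fun _ => Finset.prod_nonneg fun _ _ => (Real.exp_pos _).le),
    integral_fintype_prod_eq_prod fun _ t => Real.exp (b * t ^ 2 / 2)]
  simp [integral_exp_mul_sq_gaussianReal hb]

end GaussianMoments

section SubgaussianVector

variable {Ω : Type*} {mΩ : MeasurableSpace Ω} {μ : Measure Ω}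
  {E : Type*} [NormedAddCommGroup E] [InnerProductSpace ℝ E]

/-- A random vector `X` is sub-Gaussian with variance proxy `c` if each of its one-dimensional
marginals `⟪v, X⟫` is sub-Gaussian with variance proxy `c ‖v‖²`. -/
def IsSubgaussianVector (X : Ω → E) (c : ℝ≥0) (μ : Measure Ω) : Prop :=
  ∀ v, HasSubgaussianMGF (fun ω => ⟪v, X ω⟫) (c * ‖v‖₊ ^ 2) μ

namespace IsSubgaussianVector

variable {X : Ω → E} {c : ℝ≥0}

theorem orthogonalProjectionOnto (hX : IsSubgaussianVector X c μ) (U : Submodule ℝ E)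
    [U.HasOrthogonalProjection] :
    IsSubgaussianVector (fun ω => U.orthogonalProjectionOnto (X ω)) c μ := fun v => by
  simpa only [Submodule.inner_orthogonalProjectionOnto_eq_of_mem_left] using! hX v

theorem lintegral_exp_inner_le (hX : IsSubgaussianVector X c μ) (v : E) :
    ∫⁻ ω, ENNReal.ofReal (Real.exp ⟪v, X ω⟫) ∂μ ≤
      ENNReal.ofReal (Real.exp (c * ‖v‖ ^ 2 / 2)) := by
  have hint : Integrable (fun ω => Real.exp ⟪v, X ω⟫) μ := by
    simpa only [one_mul] using (hX v).integrable_exp_mul 1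
  rw [← ofReal_integral_eq_lintegral_ofReal hint (ae_of_all _ fun _ => (Real.exp_pos _).le)]
  exact ENNReal.ofReal_le_ofReal (by simpa [mgf] using (hX v).mgf_le 1)

variable [FiniteDimensional ℝ E]

theorem aemeasurable [MeasurableSpace E] [BorelSpace E] (hX : IsSubgaussianVector X c μ) :
    AEMeasurable X μ := by
  have hsum : X = fun ω => ∑ i, ⟪stdOrthonormalBasis ℝ E i, X ω⟫ • stdOrthonormalBasis ℝ E i :=
    funext fun ω => ((stdOrthonormalBasis ℝ E).sum_repr' (X ω)).symm
  rw [hsum]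
  exact Finset.aemeasurable_fun_sum _ fun i _ => (hX _).aemeasurable.smul_const _

-- Gaussian linearization: `exp (t ‖x‖² / 2) = 𝔼 exp (√t ⟪g, x⟫)` for a standard Gaussian `g`, so
-- Tonelli's theorem reduces the claim to the marginals of `X`.
theorem lintegral_exp_mul_norm_sq_le [SFinite μ] (hX : IsSubgaussianVector X c μ) {t : ℝ}
    (ht : 0 ≤ t) (hct : c * t < 1) :
    ∫⁻ ω, ENNReal.ofReal (Real.exp (t * ‖X ω‖ ^ 2 / 2)) ∂μ ≤
      ENNReal.ofReal ((√(1 - c * t))⁻¹ ^ Module.finrank ℝ E) := by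
  borelize E
  have hXm := hX.aemeasurable
  calc ∫⁻ ω, ENNReal.ofReal (Real.exp (t * ‖X ω‖ ^ 2 / 2)) ∂μ
      = ∫⁻ ω, ∫⁻ x, ENNReal.ofReal (Real.exp ⟪x, √t • X ω⟫) ∂(stdGaussian E) ∂μ := by
        simp_rw [lintegral_exp_inner_stdGaussian, norm_smul, mul_pow, Real.norm_eq_abs, sq_abs,
          Real.sq_sqrt ht]
    _ = ∫⁻ x, ∫⁻ ω, ENNReal.ofReal (Real.exp ⟪√t • x, X ω⟫) ∂μ ∂(stdGaussian E) := by
        simp_rw [real_inner_smul_left, ← real_inner_smul_right]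
        refine lintegral_lintegral_swap (AEMeasurable.ennreal_ofReal ?_)
        exact (AEMeasurable.inner measurable_snd.aemeasurable
          (hXm.comp_fst.const_smul (√t))).exp
    _ ≤ ∫⁻ x, ENNReal.ofReal (Real.exp (c * t * ‖x‖ ^ 2 / 2)) ∂(stdGaussian E) := by
        refine lintegral_mono fun x => (hX.lintegral_exp_inner_le _).trans_eq ?_
        rw [norm_smul, mul_pow, Real.norm_eq_abs, sq_abs, Real.sq_sqrt ht, mul_assoc (c : ℝ)]
    _ = ENNReal.ofReal ((√(1 - c * t))⁻¹ ^ Module.finrank ℝ E) :=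
        lintegral_exp_mul_norm_sq_stdGaussian hct

theorem integral_exp_mul_norm_sq_le [SFinite μ] (hX : IsSubgaussianVector X c μ) {t : ℝ}
    (ht : 0 ≤ t) (hct : c * t < 1) :
    ∫ ω, Real.exp (t * ‖X ω‖ ^ 2 / 2) ∂μ ≤ (√(1 - c * t))⁻¹ ^ Module.finrank ℝ E := by
  borelize E
  have hXm := hX.aemeasurable
  rw [integral_eq_lintegral_of_nonneg_ae (ae_of_all _ fun _ => (Real.exp_pos _).le)
    (by fun_prop)]
  exact ENNReal.toReal_le_of_le_ofReal (by positivity) (hX.lintegral_exp_mul_norm_sq_le ht hct)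

end IsSubgaussianVector

end SubgaussianVector

section ExponentialMoment

variable {Ω : Type*} {mΩ : MeasurableSpace Ω} {μ : Measure Ω} [IsProbabilityMeasure μ] {Y : Ω → ℝ}

theorem integral_nonpos_of_integral_exp_le_one (hY : Integrable Y μ)
    (hexp : Integrable (fun ω => Real.exp (Y ω)) μ) (h : ∫ ω, Real.exp (Y ω) ∂μ ≤ 1) :
    ∫ ω, Y ω ∂μ ≤ 0 :=
  Real.exp_le_one_iff.1 <| (convexOn_exp.map_integral_le Real.continuous_exp.continuousOn
    isClosed_univ (ae_of_all _ fun _ => Set.mem_univ _) hY hexp).trans h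

theorem one_sub_exp_neg_le_measureReal_of_integral_exp_le_one
    (hexp : Integrable (fun ω => Real.exp (Y ω)) μ) (h : ∫ ω, Real.exp (Y ω) ∂μ ≤ 1) (t : ℝ) :
    1 - Real.exp (-t) ≤ μ.real {ω | Y ω ≤ t} := by
  have hchernoff : μ.real {ω | t ≤ Y ω} ≤ Real.exp (-t) := by
    have := measure_ge_le_exp_mul_mgf (μ := μ) (X := Y) t zero_le_one (by simpa using hexp)
    simp only [mgf, one_mul, neg_one_mul] at this
    exact this.trans (mul_le_of_le_one_right (Real.exp_pos _).le h)
  have hcover : 1 ≤ μ.real {ω | Y ω ≤ t} + μ.real {ω | t ≤ Y ω} := by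
    refine le_trans (le_of_eq ?_) (measureReal_union_le _ _)
    have huniv : {ω | Y ω ≤ t} ∪ {ω | t ≤ Y ω} = Set.univ :=
      Set.eq_univ_of_forall fun ω => le_total (Y ω) t
    rw [huniv, probReal_univ]
  linarith

end ExponentialMoment

theorem hasSubgaussianMGF_sum_sub_integral_pi {ι : Type*} [Fintype ι] {Ω : ι → Type*}
    [∀ i, MeasurableSpace (Ω i)] {ν : ∀ i, Measure (Ω i)} [∀ i, IsProbabilityMeasure (ν i)]
    {f : ∀ i, Ω i → ℝ} (hf : ∀ i, AEMeasurable (f i) (ν i)) {r : ι → ℝ≥0}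
    (hr : ∀ i x, |f i x| ≤ r i) :
    HasSubgaussianMGF (fun ω => ∑ i, (f i (ω i) - ∫ x, f i x ∂(ν i))) (∑ i, r i ^ 2)
      (Measure.pi ν) := by
  have hoeffding (i : ι) : HasSubgaussianMGF (fun x => f i x - ∫ x, f i x ∂(ν i)) (r i ^ 2)
      (ν i) := by
    have hr' : ‖(r i : ℝ) - -r i‖₊ / 2 = r i := by
      ext
      simp [← two_mul]
    simpa only [hr'] using
      hasSubgaussianMGF_of_mem_Icc (hf i) (ae_of_all _ fun x => abs_le.1 (hr i x))
  refine HasSubgaussianMGF.sum_of_iIndepFun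
    (iIndepFun_pi fun i => (hoeffding i).aemeasurable) fun i _ => ?_
  have heval := measurePreserving_eval ν i
  exact HasSubgaussianMGF.of_map (X := fun x => f i x - ∫ x, f i x ∂(ν i)) heval.aemeasurable
    (by rw [heval.map_eq]; exact hoeffding i)

theorem sum_norm_sum_fiber_sq_le {V E : Type*} [Fintype V] [DecidableEq V]
    [SeminormedAddCommGroup E] (x : V × V → E) :
    ∑ e : Sym2 V, ‖∑ p with s(p.1, p.2) = e, x p‖ ^ 2 ≤ 2 * ∑ p, ‖x p‖ ^ 2 := by
  have hcard (e : Sym2 V) : (Finset.univ.filter fun p : V × V => s(p.1, p.2) = e).card ≤ 2 := by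
    induction e with
    | _ a b =>
      refine (Finset.card_le_card fun p hp => ?_).trans (Finset.card_le_two (a := (a, b))
        (b := (b, a)))
      simpa [Prod.ext_iff] using hp
  calc ∑ e : Sym2 V, ‖∑ p with s(p.1, p.2) = e, x p‖ ^ 2
      ≤ ∑ e : Sym2 V, 2 * ∑ p with s(p.1, p.2) = e, ‖x p‖ ^ 2 := by
        refine Finset.sum_le_sum fun e _ => ?_
        refine (pow_le_pow_left₀ (norm_nonneg _) (norm_sum_le _ _) 2).trans ?_
        refine sq_sum_le_card_mul_sum_sq.trans ?_
        gcongr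
        exact_mod_cast hcard e
    _ = 2 * ∑ p, ‖x p‖ ^ 2 := by rw [← Finset.mul_sum, Finset.sum_fiberwise]

theorem norm_sub_sq_le_of_norm_sub_sq_le {E : Type*} [NormedAddCommGroup E]
    [InnerProductSpace ℝ E] {x θ θ' η : E} (U : Submodule ℝ E) [U.HasOrthogonalProjection]
    (hfit : ‖x - η‖ ^ 2 ≤ ‖x - θ'‖ ^ 2) (hU : η - θ' ∈ U) :
    ‖η - θ‖ ^ 2 ≤ 4 * ‖θ' - θ‖ ^ 2 + 6 * ‖U.orthogonalProjectionOnto (x - θ)‖ ^ 2 := by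
  set a := ‖U.orthogonalProjectionOnto (x - θ)‖
  have hbasic : ‖η - θ‖ ^ 2 ≤ ‖θ' - θ‖ ^ 2 + 2 * ⟪x - θ, η - θ'⟫ := by
    rw [← sub_sub_sub_cancel_right x η θ, ← sub_sub_sub_cancel_right x θ' θ,
      norm_sub_sq_real (x - θ), norm_sub_sq_real (x - θ)] at hfit
    rw [← sub_sub_sub_cancel_right η θ' θ, inner_sub_right]
    linarith
  have hinner : ⟪x - θ, η - θ'⟫ ≤ a * ‖η - θ'‖ :=
    (U.inner_orthogonalProjectionOnto_eq_of_mem_right ⟨_, hU⟩ (x - θ)).symm.trans_le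
      (real_inner_le_norm _ _)
  have htri : a * ‖η - θ'‖ ≤ a * (‖η - θ‖ + ‖θ' - θ‖) :=
    mul_le_mul_of_nonneg_left (by simpa using norm_sub_le (η - θ) (θ' - θ)) (norm_nonneg _)
  nlinarith [sq_nonneg (‖η - θ‖ - 2 * a), sq_nonneg (‖θ' - θ‖ - a)]

section BlockArrays

variable {n k : ℕ} {K : Type*}

/-- An array of vectors as a point of Euclidean space, whose norm is the Frobenius norm. -/
noncomputable def flattenArray (θ : Fin n → Fin n → K → ℝ) :
    EuclideanSpace ℝ (Fin n × Fin n × K) :=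
  WithLp.toLp 2 fun p => θ p.1 p.2.1 p.2.2

/-- The space of the arrays that are constant on the blocks of the group assignment `g`. -/
noncomputable def blockSpace (K : Type*) (g : Fin n → Fin k) :
    Submodule ℝ (EuclideanSpace ℝ (Fin n × Fin n × K)) :=
  LinearMap.range ((WithLp.linearEquiv 2 ℝ (Fin n × Fin n × K → ℝ)).symm.toLinearMap ∘ₗ
    LinearMap.funLeft ℝ ℝ fun p : Fin n × Fin n × K => (g p.1, g p.2.1, p.2.2))

theorem flattenArray_mem_blockSpace (g : Fin n → Fin k) (R : Fin k → Fin k → K → ℝ) :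
    flattenArray (fun i j => R (g i) (g j)) ∈ blockSpace K g :=
  ⟨fun p => R p.1 p.2.1 p.2.2, rfl⟩

/-- The directions in which a shape model with assignment `g` may differ from the fixed array `θ'`:
the block arrays of `g` together with `θ'` itself. -/
noncomputable def fitSpace (θ' : Fin n → Fin n → K → ℝ) (g : Fin n → Fin k) :
    Submodule ℝ (EuclideanSpace ℝ (Fin n × Fin n × K)) :=
  blockSpace K g ⊔ ℝ ∙ flattenArray θ'

theorem sub_mem_fitSpace (θ' : Fin n → Fin n → K → ℝ) (g : Fin n → Fin k)
    (R : Fin k → Fin k → K → ℝ) :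
    flattenArray (fun i j => R (g i) (g j)) - flattenArray θ' ∈ fitSpace θ' g :=
  Submodule.sub_mem _ (Submodule.mem_sup_left (flattenArray_mem_blockSpace g R))
    (Submodule.mem_sup_right (Submodule.mem_span_singleton_self _))

variable [Fintype K]

theorem meanSqDist_eq_norm_sq (θ η : Fin n → Fin n → K → ℝ) :
    meanSqDist θ η = 1 / (n : ℝ) ^ 2 * ‖flattenArray θ - flattenArray η‖ ^ 2 := by
  simp [meanSqDist, EuclideanSpace.norm_sq_eq, flattenArray, Fintype.sum_prod_type]

theorem finrank_blockSpace_le (g : Fin n → Fin k) :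
    Module.finrank ℝ (blockSpace K g) ≤ Fintype.card K * k ^ 2 := by
  refine (LinearMap.finrank_range_le _).trans_eq ?_
  simp only [Module.finrank_fintype_fun_eq_card, Fintype.card_prod, Fintype.card_fin]
  ring

theorem finrank_fitSpace_le (θ' : Fin n → Fin n → K → ℝ) (g : Fin n → Fin k) :
    Module.finrank ℝ (fitSpace θ' g) ≤ Fintype.card K * k ^ 2 + 1 := by
  refine (Submodule.finrank_add_le_finrank_add_finrank _ _).trans
    (add_le_add (finrank_blockSpace_le g) ?_)
  simpa using finrank_span_le_card (R := ℝ) {flattenArray θ'}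

variable [DecidableEq K]

/-- The largest energy `‖P ε‖² / 8` of the noise `ε = X - θ`, over the orthogonal projections `P`
onto the spaces `fitSpace θ' g` of all assignments `g` of the nodes to `k` groups. -/
noncomputable def maxNoise (k : ℕ) (θ θ' : Fin n → Fin n → K → ℝ) (A : DecoratedGraph n K) : ℝ :=
  ⨆ g : Fin n → Fin k, ‖(fitSpace θ' g).orthogonalProjectionOnto
    (flattenArray (oneHot A) - flattenArray θ)‖ ^ 2 / 8

theorem IsLeastSquaresEstimator.meanSqDist_le {s : ℕ}
    {est : DecoratedGraph n K → Fin n → Fin n → K → ℝ} (hest : IsLeastSquaresEstimator s k est)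
    {θ' : Fin n → Fin n → K → ℝ} (hθ' : θ' ∈ shapeModelParams n s k K)
    (θ : Fin n → Fin n → K → ℝ) (A : DecoratedGraph n K) :
    meanSqDist (est A) θ ≤
      4 * meanSqDist θ' θ + 48 / (n : ℝ) ^ 2 * maxNoise k θ θ' A := by
  obtain rfl | hn := n.eq_zero_or_pos
  · simp [meanSqDist]
  obtain ⟨⟨g, u, Q, -, -, hQ⟩, hmin⟩ := hest A
  have hfit : ‖flattenArray (oneHot A) - flattenArray (est A)‖ ^ 2 ≤
      ‖flattenArray (oneHot A) - flattenArray θ'‖ ^ 2 := by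
    have : (0 : ℝ) < 1 / (n : ℝ) ^ 2 := by positivity
    simpa only [Set.mem_ofPred_eq, meanSqDist_eq_norm_sq, mul_le_mul_iff_right₀ this]
      using hmin hθ'
  have hmem : flattenArray (est A) - flattenArray θ' ∈ fitSpace θ' g := by
    rw [funext₂ hQ]
    exact sub_mem_fitSpace θ' g fun a b => Q (u a b)
  have hg := le_ciSup (Set.finite_range fun g => ‖(fitSpace θ' g).orthogonalProjectionOnto
    (flattenArray (oneHot A) - flattenArray θ)‖ ^ 2 / 8).bddAbove g
  calc meanSqDist (est A) θ
      = 1 / (n : ℝ) ^ 2 * ‖flattenArray (est A) - flattenArray θ‖ ^ 2 := meanSqDist_eq_norm_sq _ _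
    _ ≤ 1 / (n : ℝ) ^ 2 * (4 * ‖flattenArray θ' - flattenArray θ‖ ^ 2 +
          6 * (8 * maxNoise k θ θ' A)) := by
        gcongr
        refine (norm_sub_sq_le_of_norm_sub_sq_le _ hfit hmem).trans ?_
        gcongr
        exact (div_le_iff₀' (by norm_num)).1 hg
    _ = _ := by rw [meanSqDist_eq_norm_sq θ']; ring

end BlockArrays

namespace DecoratedGraphon

variable {K : Type*} [Fintype K] [MeasurableSpace K] [DiscreteMeasurableSpace K] {n : ℕ}

theorem integral_edgeLaw (W : DecoratedGraphon K) (ξ : Fin n → unitInterval) (e : Sym2 (Fin n))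
    (f : K → ℝ) : ∫ l, f l ∂(W.edgeLaw ξ e) = ∑ l, W.edgeProb ξ e l * f l := by
  simp [integral_fintype Integrable.of_finite, measureReal_def, edgeLaw_singleton,
    ENNReal.toReal_ofReal (W.edgeProb_nonneg ξ e _)]

variable [DecidableEq K]

theorem inner_noise_eq_sum_edges (W : DecoratedGraphon K) (ξ : Fin n → unitInterval)
    (v : EuclideanSpace ℝ (Fin n × Fin n × K)) (A : DecoratedGraph n K) :
    ⟪v, flattenArray (oneHot A) - flattenArray (W.probs ξ)⟫ =
      ∑ e, ((∑ p : Fin n × Fin n with s(p.1, p.2) = e, v (p.1, p.2, A e)) -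
        ∫ l, ∑ p : Fin n × Fin n with s(p.1, p.2) = e, v (p.1, p.2, l) ∂(W.edgeLaw ξ e)) := by
  calc ⟪v, flattenArray (oneHot A) - flattenArray (W.probs ξ)⟫
      = ∑ p : Fin n × Fin n, (v (p.1, p.2, A s(p.1, p.2)) -
          ∑ l, W.edgeProb ξ s(p.1, p.2) l * v (p.1, p.2, l)) := by
        simp [PiLp.inner_apply, Fintype.sum_prod_type, flattenArray, oneHot, probs, edgeProb_mk,
          sub_mul]
    _ = ∑ e, ∑ p : Fin n × Fin n with s(p.1, p.2) = e, (v (p.1, p.2, A e) -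
          ∑ l, W.edgeProb ξ e l * v (p.1, p.2, l)) := by
        rw [← Finset.sum_fiberwise _ fun p : Fin n × Fin n => s(p.1, p.2)]
        refine Finset.sum_congr rfl fun e _ => Finset.sum_congr rfl fun p hp => ?_
        rw [(Finset.mem_filter.1 hp).2]
    _ = _ := by
        refine Finset.sum_congr rfl fun e _ => ?_
        simp_rw [integral_edgeLaw, Finset.sum_sub_distrib, Finset.mul_sum]
        rw [Finset.sum_comm (t := Finset.univ)]

theorem isSubgaussianVector_noise (W : DecoratedGraphon K) (ξ : Fin n → unitInterval) :
    IsSubgaussianVector (fun A => flattenArray (oneHot A) - flattenArray (W.probs ξ)) 2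
      (W.graphKernel n ξ) := fun v => by
  set c : Sym2 (Fin n) → EuclideanSpace ℝ K := fun e =>
    ∑ p : Fin n × Fin n with s(p.1, p.2) = e, WithLp.toLp 2 fun l => v (p.1, p.2, l)
  have hc (e : Sym2 (Fin n)) (l : K) :
      c e l = ∑ p : Fin n × Fin n with s(p.1, p.2) = e, v (p.1, p.2, l) := by
    simp [c]
  have hedges : HasSubgaussianMGF (fun A : DecoratedGraph n K =>
      ∑ e, (c e (A e) - ∫ l, c e l ∂(W.edgeLaw ξ e))) (∑ e, ‖c e‖₊ ^ 2) (W.graphKernel n ξ) :=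
    hasSubgaussianMGF_sum_sub_integral_pi (fun _ => Measurable.of_discrete.aemeasurable)
      fun e l => PiLp.norm_apply_le (c e) l
  have hproxy : ∑ e, ‖c e‖ ^ 2 ≤ 2 * ‖v‖ ^ 2 := by
    refine (sum_norm_sum_fiber_sq_le _).trans_eq ?_
    simp [EuclideanSpace.norm_sq_eq, Fintype.sum_prod_type]
  simp_rw [inner_noise_eq_sum_edges, ← hc]
  refine ⟨hedges.integrable_exp_mul, fun t => (hedges.mgf_le t).trans ?_⟩
  push_cast
  gcongr

theorem integral_exp_maxNoise_le (W : DecoratedGraphon K) (ξ : Fin n → unitInterval) {k : ℕ}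
    (hk : 0 < k) (θ' : Fin n → Fin n → K → ℝ) :
    ∫ A, Real.exp (maxNoise k (W.probs ξ) θ' A) ∂(W.graphKernel n ξ) ≤
      (k : ℝ) ^ n * √2 ^ (Fintype.card K * k ^ 2 + 1) := by
  have : Nonempty (Fin n → Fin k) := ⟨fun _ => ⟨0, hk⟩⟩
  set noise : (Fin n → Fin k) → DecoratedGraph n K → ℝ := fun g A =>
    ‖(fitSpace θ' g).orthogonalProjectionOnto
      (flattenArray (oneHot A) - flattenArray (W.probs ξ))‖ ^ 2 / 8
  have hmax (A : DecoratedGraph n K) :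
      Real.exp (maxNoise k (W.probs ξ) θ' A) ≤ ∑ g, Real.exp (noise g A) := by
    obtain ⟨g, hg⟩ := exists_eq_ciSup_of_finite (f := fun g => noise g A)
    rw [maxNoise, ← hg]
    exact Finset.single_le_sum (fun g _ => (Real.exp_pos (noise g A)).le) (Finset.mem_univ g)
  have hnoise (g : Fin n → Fin k) : ∫ A, Real.exp (noise g A) ∂(W.graphKernel n ξ) ≤
      √2 ^ (Fintype.card K * k ^ 2 + 1) := by
    have h := ((W.isSubgaussianVector_noise ξ).orthogonalProjectionOnto
      (fitSpace θ' g)).integral_exp_mul_norm_sq_le (t := 1 / 4) (by norm_num) (by norm_num)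
    have hsqrt : (√(1 - (2 : ℝ≥0) * (1 / 4)))⁻¹ = √2 := by
      rw [← Real.sqrt_inv]; norm_num
    rw [hsqrt] at h
    refine le_trans (le_of_eq ?_) (h.trans (pow_le_pow_right₀ (Real.one_le_sqrt.2 one_le_two)
      (finrank_fitSpace_le θ' g)))
    exact integral_congr_ae (ae_of_all _ fun A => congrArg Real.exp (by simp only [noise]; ring))
  calc ∫ A, Real.exp (maxNoise k (W.probs ξ) θ' A) ∂(W.graphKernel n ξ)
      ≤ ∫ A, ∑ g, Real.exp (noise g A) ∂(W.graphKernel n ξ) :=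
        integral_mono .of_finite .of_finite hmax
    _ = ∑ g, ∫ A, Real.exp (noise g A) ∂(W.graphKernel n ξ) :=
        integral_finsetSum _ fun _ _ => .of_finite
    _ ≤ ∑ _g : Fin n → Fin k, √2 ^ (Fintype.card K * k ^ 2 + 1) :=
        Finset.sum_le_sum fun g _ => hnoise g
    _ = (k : ℝ) ^ n * √2 ^ (Fintype.card K * k ^ 2 + 1) := by simp

end DecoratedGraphon

section Approximation

/-- The midpoint of the `a`-th of `k` cells of equal length. -/
noncomputable def cellMidpoint {k : ℕ} (a : Fin k) : unitInterval :=
  ⟨(2 * a + 1) / (2 * k), by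
    have hk : (0 : ℝ) < k := by exact_mod_cast a.pos
    have ha : (a : ℝ) + 1 ≤ k := by exact_mod_cast a.isLt
    exact ⟨by positivity, (div_le_one (by positivity)).2 (by linarith)⟩⟩

theorem coe_cellMidpoint {k : ℕ} (a : Fin k) :
    (cellMidpoint a : ℝ) = (2 * a + 1) / (2 * k) := rfl

theorem cellMidpoint_mem_Ioo {k : ℕ} (a : Fin k) :
    cellMidpoint a ∈ Set.Ioo (0 : unitInterval) 1 := by
  have hk : (0 : ℝ) < k := by exact_mod_cast a.pos
  have ha : (a : ℝ) + 1 ≤ k := by exact_mod_cast a.isLt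
  rw [Set.mem_Ioo, ← Subtype.coe_lt_coe, ← Subtype.coe_lt_coe, coe_cellMidpoint,
    Set.Icc.coe_zero, Set.Icc.coe_one]
  exact ⟨by positivity, (div_lt_one (by positivity)).2 (by linarith)⟩

theorem exists_abs_sub_cellMidpoint_le {k : ℕ} (hk : 0 < k) {x : unitInterval} (hx : x < 1) :
    ∃ a : Fin k, |(cellMidpoint a : ℝ) - x| ≤ 1 / (2 * k) := by
  have hk' : (0 : ℝ) < k := by exact_mod_cast hk
  have hkx : (0 : ℝ) ≤ k * x := mul_nonneg hk'.le x.2.1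
  have hlt : ⌊k * (x : ℝ)⌋₊ < k :=
    (Nat.floor_lt hkx).2 (mul_lt_of_lt_one_right hk' (by exact_mod_cast hx))
  refine ⟨⟨⌊k * (x : ℝ)⌋₊, hlt⟩, ?_⟩
  have hscale : (cellMidpoint (⟨⌊k * (x : ℝ)⌋₊, hlt⟩ : Fin k) : ℝ) - x =
      (2 * ⌊k * (x : ℝ)⌋₊ + 1 - 2 * (k * x)) / (2 * k) := by
    rw [coe_cellMidpoint]
    field_simp
  rw [hscale, abs_div, abs_of_pos (by positivity : (0 : ℝ) < 2 * k)]
  gcongr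
  exact abs_le.2 ⟨by linarith [Nat.lt_floor_add_one (k * (x : ℝ))],
    by linarith [Nat.floor_le hkx]⟩

variable {K : Type*}

theorem mem_shapeModelParams_of_sym2 {n s k : ℕ} (hs : (k + 1).choose 2 ≤ s) (g : Fin n → Fin k)
    {P : Sym2 (Fin k) → K → ℝ} (hP : ∀ e l, P e l ∈ Set.Icc (0 : ℝ) 1) :
    (fun i j => P s(g i, g j)) ∈ shapeModelParams n s k K := by
  obtain ⟨f⟩ : Nonempty (Sym2 (Fin k) ↪ Fin s) :=
    Function.Embedding.nonempty_of_card_le (by simpa [Sym2.card] using hs)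
  refine ⟨g, fun a b => f s(a, b), Function.extend f P 0, fun a b => congrArg f Sym2.eq_swap,
    fun c l => ?_, fun i j => (f.injective.extend_apply P 0 _).symm⟩
  by_cases hc : ∃ e, f e = c
  · obtain ⟨e, rfl⟩ := hc
    rw [f.injective.extend_apply]
    exact hP e l
  · simp [Function.extend_apply' _ _ _ hc]

variable [Fintype K]

theorem meanSqDist_nonneg {n : ℕ} (θ η : Fin n → Fin n → K → ℝ) : 0 ≤ meanSqDist θ η := by
  rw [meanSqDist]
  positivity

theorem meanSqDist_le_of_forall {n : ℕ} {θ η : Fin n → Fin n → K → ℝ} {c : ℝ} (hc : 0 ≤ c)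
    (h : ∀ i j, ∑ l, (θ i j l - η i j l) ^ 2 ≤ c) : meanSqDist θ η ≤ c := by
  calc meanSqDist θ η
      ≤ 1 / (n : ℝ) ^ 2 * ∑ _i : Fin n, ∑ _j : Fin n, c := by
        rw [meanSqDist]
        gcongr with i _ j _
        exact h i j
    _ = (n : ℝ) ^ 2 / (n : ℝ) ^ 2 * c := by simp; ring
    _ ≤ c := mul_le_of_le_one_left hc (div_self_le_one _)

namespace DecoratedGraphon

variable {W : DecoratedGraphon K} {n : ℕ}

theorem card_pos (W : DecoratedGraphon K) : 0 < Fintype.card K := by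
  rw [Fintype.card_pos_iff, ← not_isEmpty_iff]
  exact fun _ => by simpa using W.sum_eq_one 0 0

theorem edgeProb_mem_Icc (W : DecoratedGraphon K) (ξ : Fin n → unitInterval) (e : Sym2 (Fin n))
    (l : K) : W.edgeProb ξ e l ∈ Set.Icc (0 : ℝ) 1 :=
  ⟨W.edgeProb_nonneg ξ e l, W.sum_edgeProb ξ e ▸
    Finset.single_le_sum (fun l _ => W.edgeProb_nonneg ξ e l) (Finset.mem_univ l)⟩

theorem measurable_meanSqDist_probs [MeasurableSpace K] [DiscreteMeasurableSpace K]
    (W : DecoratedGraphon K)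
    (est : DecoratedGraph n K → Fin n → Fin n → K → ℝ) :
    Measurable fun ω : (Fin n → unitInterval) × DecoratedGraph n K =>
      meanSqDist (est ω.2) (W.probs ω.1) := by
  refine measurable_from_prod_countable_left fun A => ?_
  have hprobs (i j : Fin n) (l : K) : Measurable fun ξ => W.probs ξ i j l :=
    W.measurable_edgeProb s(i, j) l
  simp only [meanSqDist]
  fun_prop

variable {α M : ℝ}

theorem IsHolder.sum_sq_sub_le (hW : W.IsHolder α M) (hα : 0 ≤ α) {x y x' y' : unitInterval}
    (hx : x ∈ Set.Ioo 0 1) (hy : y ∈ Set.Ioo 0 1) (hx' : x' ∈ Set.Ioo 0 1)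
    (hy' : y' ∈ Set.Ioo 0 1) {δ : ℝ} (hδ : |(x : ℝ) - x'| + |(y : ℝ) - y'| ≤ δ) :
    ∑ l, (W.w l x y - W.w l x' y') ^ 2 ≤ M ^ 2 * δ ^ (2 * α) := by
  set t := |(x : ℝ) - x'| + |(y : ℝ) - y'|
  have ht : 0 ≤ t := by positivity
  calc ∑ l, (W.w l x y - W.w l x' y') ^ 2
      ≤ (∑ l, |W.w l x y - W.w l x' y'|) ^ 2 := by
        simp_rw [← sq_abs (W.w _ x y - W.w _ x' y')]
        exact Finset.sum_sq_le_sq_sum_of_nonneg fun _ _ => abs_nonneg _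
    _ ≤ (M * t ^ α) ^ 2 :=
        pow_le_pow_left₀ (by positivity) (hW x hx y hy x' hx' y' hy') 2
    _ = M ^ 2 * t ^ (2 * α) := by
        rw [mul_pow, ← Real.rpow_mul_natCast ht, Nat.cast_ofNat, mul_comm α]
    _ ≤ M ^ 2 * δ ^ (2 * α) := by gcongr

theorem IsHolder.exists_shapeModel_near (hW : W.IsHolder α M) (hα : 0 ≤ α) {s k : ℕ} (hk : 0 < k)
    (hs : (k + 1).choose 2 ≤ s) {ξ : Fin n → unitInterval} (hξ : ∀ i, ξ i ∈ Set.Ioo 0 1) :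
    ∃ θ ∈ shapeModelParams n s k K, meanSqDist θ (W.probs ξ) ≤ M ^ 2 * (1 / k) ^ (2 * α) := by
  choose g hg using fun i => exists_abs_sub_cellMidpoint_le hk (hξ i).2
  refine ⟨fun i j => W.edgeProb cellMidpoint s(g i, g j),
    mem_shapeModelParams_of_sym2 hs g (W.edgeProb_mem_Icc cellMidpoint),
    meanSqDist_le_of_forall (by positivity) fun i j => ?_⟩
  refine hW.sum_sq_sub_le hα (cellMidpoint_mem_Ioo _) (cellMidpoint_mem_Ioo _) (hξ i) (hξ j)
    ((add_le_add (hg i) (hg j)).trans_eq ?_)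
  field_simp
  norm_num

end DecoratedGraphon

end Approximation

section Rates

variable {α : ℝ} {n : ℕ}

theorem numGroups_pos (α : ℝ) (hn : 0 < n) : 0 < numGroups α n :=
  Nat.ceil_pos.2 (Real.rpow_pos_of_pos (by exact_mod_cast hn) _)

theorem numGroups_le (hα : 0 ≤ α) (hn : 0 < n) : numGroups α n ≤ n := by
  have hn' : (1 : ℝ) ≤ n := by exact_mod_cast hn
  refine Nat.ceil_le.2 (Real.rpow_le_self_of_one_le hn' ?_)
  exact (div_le_one (by linarith)).2 (by linarith)

theorem rpow_one_div_add_one_sq (hα : 0 ≤ α) (hn : 0 < n) :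
    ((n : ℝ) ^ (1 / (α + 1))) ^ 2 = (n : ℝ) ^ 2 * (n : ℝ) ^ (-2 * α / (α + 1)) := by
  have hn' : (0 : ℝ) < n := by exact_mod_cast hn
  rw [← Real.rpow_mul_natCast hn'.le, ← Real.rpow_natCast, ← Real.rpow_add hn']
  congr 1
  push_cast
  field_simp
  ring

theorem numGroups_sq_le (hα : 0 ≤ α) (hn : 0 < n) :
    (numGroups α n : ℝ) ^ 2 ≤ 4 * ((n : ℝ) ^ 2 * (n : ℝ) ^ (-2 * α / (α + 1))) := by
  have hbase : 1 ≤ (n : ℝ) ^ (1 / (α + 1)) :=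
    Real.one_le_rpow (by exact_mod_cast hn) (by positivity)
  have hceil : (numGroups α n : ℝ) ≤ 2 * (n : ℝ) ^ (1 / (α + 1)) := by
    have hlt : (numGroups α n : ℝ) < (n : ℝ) ^ (1 / (α + 1)) + 1 :=
      Nat.ceil_lt_add_one (by positivity)
    linarith
  rw [← rpow_one_div_add_one_sq hα hn]
  nlinarith [(Nat.cast_nonneg (numGroups α n) : (0 : ℝ) ≤ _)]

theorem one_div_numGroups_rpow_le (hα : 0 ≤ α) (hn : 0 < n) :
    (1 / numGroups α n : ℝ) ^ (2 * α) ≤ (n : ℝ) ^ (-2 * α / (α + 1)) := by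
  have hn' : (0 : ℝ) < n := by exact_mod_cast hn
  calc (1 / numGroups α n : ℝ) ^ (2 * α)
      ≤ (1 / (n : ℝ) ^ (1 / (α + 1))) ^ (2 * α) := by
        gcongr
        exact Nat.le_ceil _
    _ = (n : ℝ) ^ (-2 * α / (α + 1)) := by
        rw [one_div, ← Real.rpow_neg hn'.le, ← Real.rpow_mul hn'.le]
        congr 1
        ring

theorem choose_numGroups_le_numShapes (hα : 0 < α) (hn : 16 ≤ n) :
    (numGroups α n + 1).choose 2 ≤ numShapes α 1 n := by
  have hn' : (16 : ℝ) ≤ n := by exact_mod_cast hn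
  have hmin : 0 < min α 1 := lt_min hα one_pos
  set y := (n : ℝ) ^ (1 / (min α 1 + 1))
  have hy : 4 ≤ y := by
    have hsqrt : √(n : ℝ) ≤ y := by
      rw [Real.sqrt_eq_rpow]
      exact Real.rpow_le_rpow_of_exponent_le (by linarith)
        (one_div_le_one_div_of_le (by linarith) (by linarith [min_le_right α 1]))
    exact ((Real.le_sqrt' (by norm_num)).2 (by linarith)).trans hsqrt
  have hk : (numGroups α n : ℝ) < y + 1 := by
    have hpow : (n : ℝ) ^ (1 / (α + 1)) ≤ y :=
      Real.rpow_le_rpow_of_exponent_le (by linarith)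
        (one_div_le_one_div_of_le (by linarith) (by linarith [min_le_left α 1]))
    exact (Nat.ceil_lt_add_one (by positivity)).trans_le (by linarith)
  have hs : y ^ 2 ≤ numShapes α 1 n := by
    refine le_trans (le_of_eq ?_) (Nat.le_ceil _)
    rw [← Real.rpow_mul_natCast (by positivity)]
    congr 1
    push_cast
    ring
  rw [← Nat.cast_le (α := ℝ), Nat.cast_choose_two]
  push_cast
  nlinarith [(Nat.cast_nonneg (numGroups α n) : (0 : ℝ) ≤ _)]

theorem holderRate_nonneg (L : ℕ) (α : ℝ) (n : ℕ) : 0 ≤ holderRate L α n :=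
  add_nonneg (by positivity) (div_nonneg (Real.log_natCast_nonneg n) (Nat.cast_nonneg n))

theorem mul_rpow_le_holderRate (L : ℕ) (α : ℝ) (n : ℕ) :
    L * (n : ℝ) ^ (-2 * α / (α + 1)) ≤ holderRate L α n :=
  le_add_of_nonneg_right (div_nonneg (Real.log_natCast_nonneg n) (Nat.cast_nonneg n))

theorem rpow_le_holderRate {L : ℕ} (hL : 0 < L) (α : ℝ) (n : ℕ) :
    (n : ℝ) ^ (-2 * α / (α + 1)) ≤ holderRate L α n :=
  (le_mul_of_one_le_left (by positivity) (by exact_mod_cast hL)).trans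
    (mul_rpow_le_holderRate L α n)

theorem natCast_le_mul_holderRate (L : ℕ) (hα : 0 ≤ α) (hn : 0 < n) (hn16 : n < 16) :
    (L : ℝ) ≤ 256 * holderRate L α n := by
  have hn' : (1 : ℝ) ≤ n := by exact_mod_cast hn
  have hn16' : (n : ℝ) ≤ 16 := by exact_mod_cast hn16.le
  have hbase : 1 ≤ ((n : ℝ) ^ (1 / (α + 1))) ^ 2 :=
    one_le_pow₀ (Real.one_le_rpow hn' (by positivity))
  have hr : 1 ≤ 256 * (n : ℝ) ^ (-2 * α / (α + 1)) := by
    rw [rpow_one_div_add_one_sq hα hn] at hbase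
    refine hbase.trans ?_
    gcongr
    nlinarith
  nlinarith [mul_rpow_le_holderRate L α n, (Nat.cast_nonneg L : (0 : ℝ) ≤ L)]

theorem one_div_le_mul_holderRate {L : ℕ} (hL : 0 < L) (α : ℝ) (hn : 0 < n) :
    1 / (n : ℝ) ≤ 2 * holderRate L α n := by
  obtain rfl | hn2 : n = 1 ∨ 2 ≤ n := by omega
  · have := rpow_le_holderRate hL α 1
    simp only [Nat.cast_one, Real.one_rpow] at this
    norm_num
    linarith
  · have hn' : (2 : ℝ) ≤ n := by exact_mod_cast hn2
    have hlog : 1 / 2 ≤ Real.log n := by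
      linarith [Real.log_two_gt_d9, Real.log_le_log two_pos hn']
    calc 1 / (n : ℝ) ≤ 2 * (Real.log n / n) := by
          rw [← mul_div_assoc]
          gcongr
          linarith
      _ ≤ 2 * holderRate L α n := by
          gcongr
          exact le_add_of_nonneg_left (by positivity)

/-- The logarithm of the bound on the exponential moment of `maxNoise`: the number of group
assignments, times a factor `√2` for each dimension of a `fitSpace`. -/
noncomputable def fitEntropy (L n k : ℕ) : ℝ :=
  Real.log ((k : ℝ) ^ n * √2 ^ (L * k ^ 2 + 1))

theorem fitEntropy_numGroups_le (L : ℕ) (hα : 0 ≤ α) (hn : 0 < n) :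
    fitEntropy L n (numGroups α n) ≤
      n * Real.log n + (L * (4 * ((n : ℝ) ^ 2 * (n : ℝ) ^ (-2 * α / (α + 1)))) + 1) / 2 := by
  have hk : (0 : ℝ) < numGroups α n := by exact_mod_cast numGroups_pos α hn
  have hlog_sqrt : Real.log √2 ≤ 1 / 2 := by
    rw [Real.log_sqrt two_pos.le]
    linarith [Real.log_two_lt_d9]
  have hlog_sqrt_nonneg : 0 ≤ Real.log √2 := Real.log_nonneg (Real.one_le_sqrt.2 one_le_two)
  rw [fitEntropy, Real.log_mul (by positivity) (by positivity), Real.log_pow, Real.log_pow,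
    div_eq_mul_one_div]
  push_cast
  gcongr
  · exact_mod_cast numGroups_le hα hn
  · exact numGroups_sq_le hα hn

theorem mul_fitEntropy_le_mul_holderRate (L : ℕ) (hα : 0 ≤ α) (hn : 3 ≤ n) :
    48 / (n : ℝ) ^ 2 * fitEntropy L n (numGroups α n) ≤ 96 * holderRate L α n := by
  have hn' : (3 : ℝ) ≤ n := by exact_mod_cast hn
  have hlog : 1 ≤ Real.log n := by
    rw [Real.le_log_iff_exp_le (by linarith)]
    linarith [Real.exp_one_lt_d9]
  set r := (n : ℝ) ^ (-2 * α / (α + 1)) with hr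
  calc 48 / (n : ℝ) ^ 2 * fitEntropy L n (numGroups α n)
      ≤ 48 / (n : ℝ) ^ 2 *
          (n * Real.log n + (L * (4 * ((n : ℝ) ^ 2 * r)) + n * Real.log n) / 2) := by
        gcongr
        refine (fitEntropy_numGroups_le L hα (by omega)).trans ?_
        gcongr
        nlinarith
    _ = 96 * (L * r) + 72 * (Real.log n / n) := by
        field_simp
        ring
    _ ≤ 96 * holderRate L α n := by
        rw [holderRate, ← hr]
        linarith [div_nonneg (zero_le_one.trans hlog) (zero_le_three.trans hn')]

end Rates

section Risk

variable {K : Type*} [Fintype K] [DecidableEq K] {n : ℕ} {α M : ℝ}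
  {est : DecoratedGraph n K → Fin n → Fin n → K → ℝ}

theorem IsLeastSquaresEstimator.meanSqDist_probs_le_card {s k : ℕ}
    (hest : IsLeastSquaresEstimator s k est) (W : DecoratedGraphon K) (ξ : Fin n → unitInterval)
    (A : DecoratedGraph n K) : meanSqDist (est A) (W.probs ξ) ≤ Fintype.card K := by
  obtain ⟨⟨g, u, Q, -, hQ, hest_eq⟩, -⟩ := hest A
  refine meanSqDist_le_of_forall (Nat.cast_nonneg _) fun i j => ?_
  refine (Finset.sum_le_card_nsmul _ _ 1 fun l _ => ?_).trans_eq (by simp)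
  have hfit := hQ (u (g i) (g j)) l
  have hprob : W.probs ξ i j l ∈ Set.Icc (0 : ℝ) 1 := W.edgeProb_mem_Icc ξ s(i, j) l
  rw [hest_eq, sq_le_one_iff_abs_le_one, abs_le]
  exact ⟨by linarith [hfit.1, hprob.2], by linarith [hfit.2, hprob.1]⟩

variable [MeasurableSpace K] [DiscreteMeasurableSpace K] {W : DecoratedGraphon K}

namespace DecoratedGraphon

theorem IsHolder.exists_loss_le (hW : W.IsHolder α M) (hα : 0 < α) (hn : 0 < n)
    (hest : IsLeastSquaresEstimator (numShapes α 1 n) (numGroups α n) est)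
    {ξ : Fin n → unitInterval} (hξ : ∀ i, ξ i ∈ Set.Ioo 0 1) :
    ∃ Y : DecoratedGraph n K → ℝ, ∫ A, Real.exp (Y A) ∂(W.graphKernel n ξ) ≤ 1 ∧
      ∀ A, meanSqDist (est A) (W.probs ξ) ≤
        (4 * M ^ 2 + 256) * holderRate (Fintype.card K) α n + 48 / (n : ℝ) ^ 2 * Y A := by
  have hrate := holderRate_nonneg (Fintype.card K) α n
  rcases lt_or_ge n 16 with hsmall | hlarge
  · refine ⟨0, by simp, fun A => (hest.meanSqDist_probs_le_card W ξ A).trans ?_⟩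
    have hcard := natCast_le_mul_holderRate (Fintype.card K) hα.le hn hsmall
    simp only [Pi.zero_apply]
    nlinarith [mul_nonneg (sq_nonneg M) hrate]
  have hk := numGroups_pos α hn
  obtain ⟨θ', hθ', happrox⟩ := hW.exists_shapeModel_near hα.le hk
    (choose_numGroups_le_numShapes hα hlarge) hξ
  refine ⟨fun A => maxNoise (numGroups α n) (W.probs ξ) θ' A -
    fitEntropy (Fintype.card K) n (numGroups α n), ?_, fun A => ?_⟩
  · simp_rw [Real.exp_sub, integral_div, fitEntropy]
    rw [Real.exp_log (by positivity), div_le_one (by positivity)]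
    exact W.integral_exp_maxNoise_le ξ hk θ'
  · have happrox' : meanSqDist θ' (W.probs ξ) ≤ M ^ 2 * holderRate (Fintype.card K) α n := by
      refine happrox.trans (mul_le_mul_of_nonneg_left ?_ (sq_nonneg M))
      exact (one_div_numGroups_rpow_le hα.le hn).trans (rpow_le_holderRate W.card_pos α n)
    have hentropy := mul_fitEntropy_le_mul_holderRate (Fintype.card K) hα.le
      (by omega : 3 ≤ n)
    linarith [hest.meanSqDist_le hθ' (W.probs ξ) A]

theorem IsHolder.le_graphKernel_real_loss_le (hW : W.IsHolder α M) (hα : 0 < α) (hn : 0 < n)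
    (hest : IsLeastSquaresEstimator (numShapes α 1 n) (numGroups α n) est) {c : ℝ} (hc : 0 ≤ c)
    {ξ : Fin n → unitInterval} (hξ : ∀ i, ξ i ∈ Set.Ioo 0 1) :
    1 - Real.exp (-c * n) ≤ (W.graphKernel n ξ).real {A | meanSqDist (est A) (W.probs ξ) ≤
      (4 * M ^ 2 + 256 + 96 * c) * holderRate (Fintype.card K) α n} := by
  obtain ⟨Y, hY, hloss⟩ := hW.exists_loss_le hα hn hest hξ
  have htail := one_sub_exp_neg_le_measureReal_of_integral_exp_le_one .of_finite hY (c * n)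
  rw [neg_mul]
  refine htail.trans (measureReal_mono fun A (hA : Y A ≤ c * n) => (hloss A).trans ?_)
  have hdev : 48 / (n : ℝ) ^ 2 * Y A ≤ 96 * c * holderRate (Fintype.card K) α n :=
    calc 48 / (n : ℝ) ^ 2 * Y A ≤ 48 / (n : ℝ) ^ 2 * (c * n) := by gcongr
      _ = 48 * c * (1 / n) := by field_simp
      _ ≤ 48 * c * (2 * holderRate (Fintype.card K) α n) := by
        gcongr
        exact one_div_le_mul_holderRate W.card_pos α hn
      _ = 96 * c * holderRate (Fintype.card K) α n := by ring
  linarith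

theorem IsHolder.integral_loss_le (hW : W.IsHolder α M) (hα : 0 < α) (hn : 0 < n)
    (hest : IsLeastSquaresEstimator (numShapes α 1 n) (numGroups α n) est)
    {ξ : Fin n → unitInterval} (hξ : ∀ i, ξ i ∈ Set.Ioo 0 1) :
    ∫ A, meanSqDist (est A) (W.probs ξ) ∂(W.graphKernel n ξ) ≤
      (4 * M ^ 2 + 256) * holderRate (Fintype.card K) α n := by
  obtain ⟨Y, hY, hloss⟩ := hW.exists_loss_le hα hn hest hξ
  have hmean := integral_nonpos_of_integral_exp_le_one .of_finite .of_finite hY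
  refine (integral_mono .of_finite .of_finite hloss).trans ?_
  rw [integral_add (integrable_const _) .of_finite, integral_const, probReal_univ, one_smul,
    integral_const_mul]
  exact add_le_of_nonpos_right (mul_nonpos_of_nonneg_of_nonpos (by positivity) hmean)

end DecoratedGraphon

theorem ae_forall_mem_Ioo (n : ℕ) :
    ∀ᵐ ξ ∂(volume : Measure (Fin n → unitInterval)), ∀ i, ξ i ∈ Set.Ioo 0 1 := by
  refine ae_all_iff.2 fun i => ?_
  have hIoo : ∀ᵐ x : unitInterval, x ∈ Set.Ioo 0 1 := by
    filter_upwards [Measure.ae_ne volume 0, Measure.ae_ne volume 1] with x hx0 hx1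
    exact ⟨unitInterval.pos_iff_ne_zero.2 hx0, unitInterval.lt_one_iff_ne_one.2 hx1⟩
  exact (measurePreserving_eval (fun _ => volume) i).quasiMeasurePreserving.ae hIoo

theorem le_measureReal_compProd {Ω Ω' : Type*} [MeasurableSpace Ω] [MeasurableSpace Ω']
    {μ : Measure Ω} [IsProbabilityMeasure μ] {κ : Kernel Ω Ω'} [IsMarkovKernel κ]
    {S : Set (Ω × Ω')} (hS : MeasurableSet S) {q : ℝ}
    (h : ∀ᵐ ω ∂μ, q ≤ (κ ω).real (Prod.mk ω ⁻¹' S)) : q ≤ (μ ⊗ₘ κ).real S := by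
  rw [measureReal_def, ← ENNReal.ofReal_le_iff_le_toReal (measure_ne_top _ _),
    Measure.compProd_apply hS]
  calc ENNReal.ofReal q = ∫⁻ _, ENNReal.ofReal q ∂μ := by simp
    _ ≤ ∫⁻ ω, κ ω (Prod.mk ω ⁻¹' S) ∂μ := lintegral_mono_ae <| h.mono fun ω hω =>
      (ENNReal.ofReal_le_iff_le_toReal (measure_ne_top _ _)).2 hω

theorem mainTheorem2_general (hα : 0 < α) (hn : 0 < n)
    (hest : IsLeastSquaresEstimator (numShapes α 1 n) (numGroups α n) est)
    (hW : W.IsHolder α M) :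
    (∀ c : ℝ, 0 ≤ c → 1 - Real.exp (-c * n) ≤
      (W.sampleLaw n).real {ω | meanSqDist (est ω.2) (W.probs ω.1) ≤
        (4 * M ^ 2 + 256 + 96 * c) * holderRate (Fintype.card K) α n}) ∧
    ∫⁻ ω, ENNReal.ofReal (meanSqDist (est ω.2) (W.probs ω.1)) ∂(W.sampleLaw n) ≤
      ENNReal.ofReal ((4 * M ^ 2 + 256) * holderRate (Fintype.card K) α n) := by
  have hmeas := W.measurable_meanSqDist_probs est
  refine ⟨fun c hc => le_measureReal_compProd (measurableSet_le hmeas measurable_const) ?_, ?_⟩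
  · filter_upwards [ae_forall_mem_Ioo n] with ξ hξ
    exact hW.le_graphKernel_real_loss_le hα hn hest hc hξ
  · rw [DecoratedGraphon.sampleLaw, Measure.lintegral_compProd hmeas.ennreal_ofReal]
    refine (lintegral_mono_ae (g := fun _ => ENNReal.ofReal
      ((4 * M ^ 2 + 256) * holderRate (Fintype.card K) α n)) ?_).trans_eq (by simp)
    filter_upwards [ae_forall_mem_Ioo n] with ξ hξ
    rw [← ofReal_integral_eq_lintegral_ofReal .of_finite
      (ae_of_all _ fun A => meanSqDist_nonneg _ _)]
    exact ENNReal.ofReal_le_ofReal (hW.integral_loss_le hα hn hest hξ)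

end Risk

theorem mainTheorem2 (M : ℝ) :
    ∃ C₁ : ℝ, 0 < C₁ ∧ ∀ α : ℝ, 0 < α → α ≤ 1 → ∃ β : ℝ, 1 ≤ β ∧
      (∀ C' : ℝ, 0 < C' → ∃ C : ℝ, 0 < C ∧
        ∀ (K : Type*) [Fintype K] [DecidableEq K] [MeasurableSpace K] [DiscreteMeasurableSpace K]
          (n : ℕ), Fintype.card K < n →
        ∀ est : DecoratedGraph n K → Fin n → Fin n → K → ℝ,
          IsLeastSquaresEstimator (numShapes α β n) (numGroups α n) est →
        ∀ W : DecoratedGraphon K, W.IsHolder α M →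
          1 - Real.exp (-C' * n) ≤
            (W.sampleLaw n).real
              {ω | meanSqDist (est ω.2) (W.probs ω.1) ≤ C * holderRate (Fintype.card K) α n}) ∧
      (∀ (K : Type*) [Fintype K] [DecidableEq K] [MeasurableSpace K] [DiscreteMeasurableSpace K]
          (n : ℕ), Fintype.card K < n →
        ∀ est : DecoratedGraph n K → Fin n → Fin n → K → ℝ,
          IsLeastSquaresEstimator (numShapes α β n) (numGroups α n) est →
        ⨆ (W : DecoratedGraphon K) (_ : W.IsHolder α M),
            ∫⁻ ω, ENNReal.ofReal (meanSqDist (est ω.2) (W.probs ω.1)) ∂(W.sampleLaw n) ≤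
          ENNReal.ofReal (C₁ * holderRate (Fintype.card K) α n)) := by
  refine ⟨4 * M ^ 2 + 256, by positivity, fun α hα _ => ⟨1, le_rfl, fun C' hC' =>
    ⟨4 * M ^ 2 + 256 + 96 * C', by positivity, ?_⟩, ?_⟩⟩
  · intro K _ _ _ _ n hn est hest W hW
    exact (mainTheorem2_general hα (Nat.zero_lt_of_lt hn) hest hW).1 C' hC'.le
  · intro K _ _ _ _ n hn est hest
    exact iSup₂_le fun W hW => (mainTheorem2_general hα (Nat.zero_lt_of_lt hn) hest hW).2
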